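/- Let $I=[-1,1]$, let $D_s=\{z\in\mathbb{C}:|z|<s\}$, and let $\gamma=(1+\sqrt2)^2$. Let $T\colon I\to I$ be an analytic full branch map: $I=\bigcup_{\ell=1}^d I_\ell$ for closed intervals $I_\ell$ with disjoint interiors, and for each $\ell$ the restriction of $T$ to $\operatorname{int}(I_\ell)$ is an analytic diffeomorphism onto its image and $\overline{T(I_\ell)}=I$. Let $1<r<R$, and assume that each inverse branch $\varphi_\ell\colon I\to I_\ell$ of $T$ extends to a holomorphic function on $D_R$ with $\varphi_\ell(D_R)\subseteq D_r$. Assume $r/R<1/\gamma$ and let $\rho\in(r,R)$. For integers $N\ge 0$, $M\ge 1$ and for $0\le\delta\le 2/M$ put $x_m=-1+\delta+2m/M$ $(m=0,\dots,M-1)$, and define $N\times N$ matrices, with indices $k,\ell\in\{0,\dots,N-1\}$, by $$(\hat H_N^{(M)})_{k\ell}=\frac1M\sum_{m=0}^{M-1}x_m^k x_m^\ell,\quad (\hat G_N^{(M)})_{k\ell}=\frac1M\sum_{m=0}^{M-1}T(x_m)^k x_m^\ell,$$ $$(\hat H_N)_{k\ell}=\frac12\int_{-1}^1x^kx^\ell\,dx,\quad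 (\hat G_N)_{k\ell}=\frac12\int_{-1}^1T(x)^kx^\ell\,dx .$$ Extend $N\times N$ matrices by zero to operators of rank at most $N$ on $\ell^2(\mathbb{N}_0)$, and denote by $(H_N^{(M)})^\dagger$, $G_N^{(M)}$, $H_N^\dagger$, $G_N$, $V_N$, $V_N^{-1}$ the operators obtained in this way from $(\hat H_N^{(M)})^{-1}$, $\hat G_N^{(M)}$, $\hat H_N^{-1}$, $\hat G_N$, $\operatorname{diag}(\rho^n)_{0\le n<N}$ and $\operatorname{diag}(\rho^{-n})_{0\le n<N}$, respectively. Then there exist constants $C_1,C_2>0$, independent of $N$, $M$ and $\delta$, such that for all integers $N\ge0$ and $M\ge 1$ with $M\ge C_1N^2\gamma^N$, and all $0\le\delta\le2/M$, the matrices $\hat H_N$ and $\hat H_N^{(M)}$ are invertible and $$\bigl\|V_N(H_N^{(M)})^\dagger G_N^{(M)}V_N^{-1}-V_NH_N^\dagger G_NV_N^{-1}\bigr\|_{\ell^2\to\ell^2}\le C_2(\rho\gamma)^N\frac{N^2}{M}.$$ -/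

import Mathlib

namespace EDMD

noncomputable section

/-! ## Analytic full branch maps of the interval `[-1, 1]` -/

/-- `f` restricted to `U` is an analytic diffeomorphism onto its image: the image is open,
`f` is analytic on `U`, and there is an analytic inverse on the image. -/
def IsAnalyticDiffeoOn (f : ℝ → ℝ) (U : Set ℝ) : Prop :=
  IsOpen (f '' U) ∧ AnalyticOnNhd ℝ f U ∧
    ∃ g : ℝ → ℝ, AnalyticOnNhd ℝ g (f '' U) ∧ Set.LeftInvOn g f U

/-- `T` is an analytic full branch map of `[-1, 1]`, with branches living on the closed intervals
`I 0, …, I (d - 1)`. Only the values of `T` on `[-1, 1]` are relevant, and at the endpoints of the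
intervals `T` may take arbitrary values in `[-1, 1]`. -/
structure IsAnalyticFullBranchMap (T : ℝ → ℝ) (d : ℕ) (I : Fin d → Set ℝ) : Prop where
  mapsTo : Set.MapsTo T (Set.Icc (-1) 1) (Set.Icc (-1) 1)
  isClosedInterval : ∀ l, ∃ a b : ℝ, I l = Set.Icc a b
  disjoint_interior : Pairwise fun l l' => Disjoint (interior (I l)) (interior (I l'))
  cover : ⋃ l, I l = Set.Icc (-1) 1
  diffeo : ∀ l, IsAnalyticDiffeoOn T (interior (I l))
  full : ∀ l, closure (T '' I l) = Set.Icc (-1) 1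

/-- `φ` is a holomorphic function on the open disk of radius `R` centred at `0`, with values in the
open disk of radius `r` (so that `φ` is bounded), whose restriction to `[-1, 1]` is the inverse
branch `[-1, 1] → J` of `T`, that is, the inverse of the restriction of `T` to the interior of the
interval `J`, extended continuously to `[-1, 1]`. -/
structure IsInverseBranchExtension (T : ℝ → ℝ) (J : Set ℝ) (r R : ℝ) (φ : ℂ → ℂ) : Prop where
  holomorphic : DifferentiableOn ℂ φ (Metric.ball 0 R)
  mapsTo_disk : Set.MapsTo φ (Metric.ball 0 R) (Metric.ball 0 r)
  mapsTo_interval : ∀ y ∈ Set.Icc (-1 : ℝ) 1, ∃ x ∈ J, φ (y : ℂ) = (x : ℂ)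
  leftInv : ∀ x ∈ interior J, φ ((T x : ℝ) : ℂ) = (x : ℂ)

/-! ## The EDMD matrices for monomials -/

/-- The equidistant nodes `x_m = -1 + δ + 2 m / M`. -/
def node (M : ℕ) (δ : ℝ) (m : ℕ) : ℝ := -1 + δ + 2 * (m : ℝ) / (M : ℝ)

/-- The `N × N` matrix with entries `(1 / M) ∑_{m < M} x_m ^ k * x_m ^ l`. -/
def nodeH (N M : ℕ) (δ : ℝ) : Matrix (Fin N) (Fin N) ℝ :=
  Matrix.of fun k l =>
    (1 / (M : ℝ)) * ∑ m ∈ Finset.range M, node M δ m ^ (k : ℕ) * node M δ m ^ (l : ℕ)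

/-- The `N × N` matrix with entries `(1 / M) ∑_{m < M} T (x_m) ^ k * x_m ^ l`. -/
def nodeG (T : ℝ → ℝ) (N M : ℕ) (δ : ℝ) : Matrix (Fin N) (Fin N) ℝ :=
  Matrix.of fun k l =>
    (1 / (M : ℝ)) * ∑ m ∈ Finset.range M, T (node M δ m) ^ (k : ℕ) * node M δ m ^ (l : ℕ)

/-- The `N × N` matrix with entries `(1 / 2) ∫_{-1}^1 x ^ k * x ^ l dx`. -/
def limitH (N : ℕ) : Matrix (Fin N) (Fin N) ℝ :=
  Matrix.of fun k l => (1 / 2) * ∫ x in (-1 : ℝ)..1, x ^ (k : ℕ) * x ^ (l : ℕ)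

/-- The `N × N` matrix with entries `(1 / 2) ∫_{-1}^1 T x ^ k * x ^ l dx`. -/
def limitG (T : ℝ → ℝ) (N : ℕ) : Matrix (Fin N) (Fin N) ℝ :=
  Matrix.of fun k l => (1 / 2) * ∫ x in (-1 : ℝ)..1, T x ^ (k : ℕ) * x ^ (l : ℕ)

/-! ## Finite rank operators on `ℓ²(ℕ)` -/

/-- The complex Hilbert space `ℓ²(ℕ)`. -/
abbrev Ell2 : Type := lp (fun _ : ℕ => ℂ) 2

/-- The standard basis vector `n` of `ℓ²(ℕ)`. -/
def stdVec (n : ℕ) : Ell2 := lp.single 2 n (1 : ℂ)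

/-- The operator `x ↦ x_l • (k-th basis vector)` on `ℓ²(ℕ)`. -/
def matrixUnit (k l : ℕ) : Ell2 →L[ℂ] Ell2 :=
  ContinuousLinearMap.smulRight (innerSL ℂ (stdVec l)) (stdVec k)

/-- The lift of an `N × N` matrix `A` to the operator of rank at most `N` on `ℓ²(ℕ)` which has
`A` as its leading `N × N` section and vanishing matrix entries elsewhere. -/
def lift {N : ℕ} (A : Matrix (Fin N) (Fin N) ℝ) : Ell2 →L[ℂ] Ell2 :=
  ∑ k : Fin N, ∑ l : Fin N, ((A k l : ℝ) : ℂ) • matrixUnit k l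

/-- `V_N`, the compression to the first `N` coordinates of `(x_n) ↦ (ρ ^ n x_n)`. -/
def opV (ρ : ℝ) (N : ℕ) : Ell2 →L[ℂ] Ell2 :=
  lift (Matrix.diagonal fun n : Fin N => ρ ^ (n : ℕ))

/-- `V_N⁻¹`, the compression to the first `N` coordinates of `(x_n) ↦ (ρ ^ (-n) x_n)`. -/
def opVinv (ρ : ℝ) (N : ℕ) : Ell2 →L[ℂ] Ell2 :=
  lift (Matrix.diagonal fun n : Fin N => (ρ ^ (n : ℕ))⁻¹)

/-- The lift of the inverse of the matrix `nodeH N M δ`. -/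
def opNodeHdagger (N M : ℕ) (δ : ℝ) : Ell2 →L[ℂ] Ell2 := lift (nodeH N M δ)⁻¹

/-- The lift of the matrix `nodeG T N M δ`. -/
def opNodeG (T : ℝ → ℝ) (N M : ℕ) (δ : ℝ) : Ell2 →L[ℂ] Ell2 := lift (nodeG T N M δ)

/-- The lift of the inverse of the matrix `limitH N`. -/
def opHdagger (N : ℕ) : Ell2 →L[ℂ] Ell2 := lift (limitH N)⁻¹

/-- The lift of the matrix `limitG T N`. -/
def opG (T : ℝ → ℝ) (N : ℕ) : Ell2 →L[ℂ] Ell2 := lift (limitG T N)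

end

end EDMD

namespace EDMD

open Polynomial Polynomial.Chebyshev Matrix

/-! ## Coercivity of the Gram matrix of the monomials -/

/-! Write γ = (1+√2)². Three estimates carry the bound.

Coercivity (`limitH_coercive`): expand p = ∑ c_k x^k as ∑ a_n U_n. The U_n are orthogonal for the
weight √(1-x²) ≤ 1, so ∫ p² ≥ (π/2) ∑ a_n², while the coefficients of U_n have ℓ¹ norm at most
(1+√2)^n. Hence the Gram matrix H is at least γ^{-N}/2.

Quadrature (`abs_node_mean_sub_integral_le`): T is monotone on finitely many branches, hence of
bounded variation, so every entry of G and H is approximated within O(N/M). For M ≥ 16 N² γ^N this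
leaves the discrete Gram matrix H' at least γ^{-N}/4.

Columns of the limit (`exists_sum_abs_limitH_inv_mul_limitG_le`): changing variables along the
branches turns column l of G into moments of F_l = ∑ ±φ^l φ', which is holomorphic on D_R and O(r^l)
on |z| = q for any 1 < q < R. Taylor truncation costs O(r^l q^{-N}); since R > γ one may take q > γ,
which beats the norm of H⁻¹. So u = H⁻¹G e_l has ℓ¹ norm O(r^l), with no growth in N.

With G' the discrete G, the column x of H'⁻¹G' - H⁻¹G satisfies H'x = (G'-G)e_l - (H'-H)u. As u is
bounded, inverting H' costs only one factor γ^N. Conjugation by V multiplies column l by at most ρ^N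
ρ^{-l}, and r < ρ makes the sum over l geometric. -/

theorem sum_abs_coeff_U_le (n K : ℕ) :
    ∑ k ∈ Finset.range K, |(U ℝ n).coeff k| ≤ (1 + √2) ^ n := by
  induction n using Nat.twoStepInduction generalizing K with
  | zero =>
    rcases K with _ | K
    · simp
    · simp [Finset.sum_range_succ', coeff_one]
  | one =>
    have h2 : (1 : ℝ) ≤ √2 := Real.one_le_sqrt.2 (by norm_num)
    rcases K with _ | _ | K
    · simp; positivity
    · simp [mul_comm (2 : ℝ[X])]; positivity
    · have : ∀ k : ℕ, (U ℝ ((1 : ℕ) : ℤ)).coeff (k + 1) = if k = 0 then 2 else 0 := by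
        intro k
        rw [Nat.cast_one, U_one, ← C_ofNat, coeff_C_mul, coeff_X]
        rcases k with _ | k <;> simp
      rw [Finset.sum_range_succ', Finset.sum_range_succ']
      simp only [this]
      simp
      linarith
  | more n ih1 ih2 =>
    -- 1+√2 is the positive root of t² = 2t + 1, the characteristic equation of U_{n+2} = 2X U_{n+1}
    -- - U_n once the triangle inequality has replaced the minus sign by a plus.
    have hs : (1 + √2) ^ 2 = 2 * (1 + √2) + 1 := by
      have := Real.sq_sqrt (show (0 : ℝ) ≤ 2 by norm_num)
      linarith [add_sq 1 (√2)]
    have hU : U ℝ ((n + 2 : ℕ) : ℤ) = X * (C 2 * U ℝ ((n + 1 : ℕ) : ℤ)) - U ℝ (n : ℤ) := by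
      push_cast
      rw [U_add_two, C_ofNat]
      ring
    have key : ∑ k ∈ Finset.range K, |(X * (C 2 * U ℝ ((n + 1 : ℕ) : ℤ))).coeff k|
        ≤ 2 * (1 + √2) ^ (n + 1) := by
      rcases K with _ | K
      · simp; positivity
      · rw [Finset.sum_range_succ']
        simp only [coeff_X_mul, coeff_C_mul, abs_mul, ← Finset.mul_sum, coeff_X_mul_zero]
        simpa using ih2 K
    calc ∑ k ∈ Finset.range K, |(U ℝ ((n + 2 : ℕ) : ℤ)).coeff k|
        ≤ ∑ k ∈ Finset.range K, (|(X * (C 2 * U ℝ ((n + 1 : ℕ) : ℤ))).coeff k|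
            + |(U ℝ (n : ℤ)).coeff k|) := by
          refine Finset.sum_le_sum fun k _ => ?_
          rw [hU, coeff_sub]
          exact abs_sub _ _
      _ ≤ 2 * (1 + √2) ^ (n + 1) + (1 + √2) ^ n := by
          rw [Finset.sum_add_distrib]
          exact add_le_add key (ih1 K)
      _ = (1 + √2) ^ (n + 2) := by
          rw [pow_add _ n 2, hs]; ring

theorem sum_sq_coeff_U_le (n K : ℕ) :
    ∑ k ∈ Finset.range K, (U ℝ n).coeff k ^ 2 ≤ ((1 + √2) ^ 2) ^ n := by
  calc ∑ k ∈ Finset.range K, (U ℝ n).coeff k ^ 2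
      = ∑ k ∈ Finset.range K, |(U ℝ n).coeff k| ^ 2 := by simp
    _ ≤ (∑ k ∈ Finset.range K, |(U ℝ n).coeff k|) ^ 2 :=
        Finset.sum_sq_le_sq_sum_of_nonneg fun _ _ => abs_nonneg _
    _ ≤ ((1 + √2) ^ n) ^ 2 := by
        gcongr
        exact sum_abs_coeff_U_le n K
    _ = _ := by rw [← pow_mul, ← pow_mul, mul_comm]

/-- The coefficient matrix of the Chebyshev polynomials of the second kind. -/
noncomputable def coeffU (N : ℕ) : Matrix (Fin N) (Fin N) ℝ := Matrix.of fun n k => (U ℝ (n : ℕ)).coeff k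

theorem isUnit_coeffU (N : ℕ) : IsUnit (coeffU N) := by
  rw [Matrix.isUnit_iff_isUnit_det, isUnit_iff_ne_zero, Matrix.det_of_isLowerTriangular]
  · refine Finset.prod_ne_zero_iff.2 fun i _ => ?_
    have h1 : (U ℝ ((i : ℕ) : ℤ)).natDegree = i := by simp
    have h2 : (U ℝ ((i : ℕ) : ℤ)).leadingCoeff ≠ 0 := by
      rw [leadingCoeff_U_natCast]; positivity
    rwa [leadingCoeff, h1] at h2
  · intro i j hij
    have h1 : (U ℝ ((i : ℕ) : ℤ)).natDegree = i := by simp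
    refine coeff_eq_zero_of_natDegree_lt ?_
    rw [h1]
    exact hij

theorem eval_U_eq_sum (N : ℕ) (n : Fin N) (x : ℝ) :
    (U ℝ (n : ℕ)).eval x = ∑ k : Fin N, coeffU N n k * x ^ (k : ℕ) := by
  have h1 : (U ℝ ((n : ℕ) : ℤ)).natDegree = n := by simp
  rw [eval_eq_sum_range' (n := N) (by rw [h1]; exact n.2), ← Fin.sum_univ_eq_sum_range
    (fun k => (U ℝ ((n : ℕ) : ℤ)).coeff k * x ^ k)]
  rfl

theorem integral_sin_mul_sin (n m : ℕ) :
    ∫ θ in (0 : ℝ)..Real.pi, Real.sin ((n + 1 : ℝ) * θ) * Real.sin ((m + 1 : ℝ) * θ)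
      = if n = m then Real.pi / 2 else 0 := by
  have hcos : ∀ k : ℤ, k ≠ 0 → ∫ θ in (0 : ℝ)..Real.pi, Real.cos (k * θ) = 0 := by
    intro k hk
    have hk' : (k : ℝ) ≠ 0 := by exact_mod_cast hk
    rw [intervalIntegral.integral_comp_mul_left _ hk']
    simp [Real.sin_int_mul_pi]
  have h : ∀ θ : ℝ, Real.sin ((n + 1 : ℝ) * θ) * Real.sin ((m + 1 : ℝ) * θ)
      = (1 / 2) * Real.cos (((n - m : ℤ) : ℝ) * θ)
        - (1 / 2) * Real.cos (((n + m + 2 : ℤ) : ℝ) * θ) := by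
    intro θ
    have e1 : ((n - m : ℤ) : ℝ) * θ = (n + 1 : ℝ) * θ - (m + 1 : ℝ) * θ := by push_cast; ring
    have e2 : ((n + m + 2 : ℤ) : ℝ) * θ = (n + 1 : ℝ) * θ + (m + 1 : ℝ) * θ := by push_cast; ring
    rw [e1, e2, Real.cos_sub, Real.cos_add]
    ring
  simp only [h]
  rw [intervalIntegral.integral_sub
    (Continuous.intervalIntegrable (by fun_prop) _ _)
    (Continuous.intervalIntegrable (by fun_prop) _ _),
    intervalIntegral.integral_const_mul, intervalIntegral.integral_const_mul,
    hcos (n + m + 2) (by positivity)]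
  split_ifs with hnm
  · subst hnm
    simp
    ring
  · rw [hcos _ (by omega)]
    simp

theorem integral_sq_sum_sin {N : ℕ} (a : Fin N → ℝ) :
    ∫ θ in (0 : ℝ)..Real.pi, (∑ n : Fin N, a n * Real.sin (((n : ℕ) + 1 : ℝ) * θ)) ^ 2
      = Real.pi / 2 * ∑ n, a n ^ 2 := by
  have h : ∀ θ : ℝ, (∑ n : Fin N, a n * Real.sin (((n : ℕ) + 1 : ℝ) * θ)) ^ 2
      = ∑ n : Fin N, ∑ m : Fin N, a n * a m *
        (Real.sin (((n : ℕ) + 1 : ℝ) * θ) * Real.sin (((m : ℕ) + 1 : ℝ) * θ)) := by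
    intro θ
    rw [sq, Finset.sum_mul_sum]
    exact Finset.sum_congr rfl fun n _ => Finset.sum_congr rfl fun m _ => by ring
  simp only [h]
  rw [intervalIntegral.integral_finsetSum
    fun n _ => Continuous.intervalIntegrable (by fun_prop) _ _, Finset.mul_sum]
  refine Finset.sum_congr rfl fun n _ => ?_
  rw [intervalIntegral.integral_finsetSum
    fun m _ => Continuous.intervalIntegrable (by fun_prop) _ _]
  simp only [intervalIntegral.integral_const_mul, integral_sin_mul_sin, Fin.val_inj]
  simp
  ring

/-- The substitution x = cos θ supplies one factor sin θ; the second is at most 1. It is inserted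
because U_n(cos θ) sin θ = sin((n+1)θ), an orthogonal family on [0, π]. -/
theorem integral_comp_cos_mul_sin_sq_le {f : ℝ → ℝ} (hf : Continuous f) :
    ∫ θ in (0 : ℝ)..Real.pi, (f (Real.cos θ) * Real.sin θ) ^ 2 ≤ ∫ x in (-1 : ℝ)..1, f x ^ 2 := by
  have hsub : ∫ x in (-1 : ℝ)..1, f x ^ 2
      = ∫ θ in (0 : ℝ)..Real.pi, f (Real.cos θ) ^ 2 * Real.sin θ := by
    have := intervalIntegral.integral_comp_mul_deriv (a := 0) (b := Real.pi)
      (f := Real.cos) (f' := fun θ => -Real.sin θ) (g := fun x => f x ^ 2)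
      (fun θ _ => Real.hasDerivAt_cos θ) (by fun_prop) (by fun_prop)
    rw [Real.cos_zero, Real.cos_pi] at this
    rw [intervalIntegral.integral_symm, ← this, ← intervalIntegral.integral_neg]
    simp
  rw [hsub]
  refine intervalIntegral.integral_mono_on Real.pi_pos.le
    (Continuous.intervalIntegrable (by fun_prop) _ _)
    (Continuous.intervalIntegrable (by fun_prop) _ _) fun θ hθ => ?_
  have h0 := Real.sin_nonneg_of_mem_Icc hθ
  have h1 := Real.sin_le_one θ
  rw [mul_pow]
  gcongr
  nlinarith

theorem dotProduct_limitH_mulVec {N : ℕ} (c : Fin N → ℝ) :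
    c ⬝ᵥ limitH N *ᵥ c = 1 / 2 * ∫ x in (-1 : ℝ)..1, (∑ k, c k * x ^ (k : ℕ)) ^ 2 := by
  have h : ∀ x : ℝ, (∑ k, c k * x ^ (k : ℕ)) ^ 2
      = ∑ k, ∑ l, c k * c l * (x ^ (k : ℕ) * x ^ (l : ℕ)) := by
    intro x
    rw [sq, Finset.sum_mul_sum]
    exact Finset.sum_congr rfl fun n _ => Finset.sum_congr rfl fun m _ => by ring
  simp only [h]
  rw [intervalIntegral.integral_finsetSum
    fun n _ => Continuous.intervalIntegrable (by fun_prop) _ _, Finset.mul_sum]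
  refine Finset.sum_congr rfl fun n _ => ?_
  rw [intervalIntegral.integral_finsetSum
    fun m _ => Continuous.intervalIntegrable (by fun_prop) _ _]
  simp only [intervalIntegral.integral_const_mul, mulVec, dotProduct, limitH, of_apply,
    Finset.mul_sum]
  exact Finset.sum_congr rfl fun m _ => by ring

theorem limitH_coercive {N : ℕ} (c : Fin N → ℝ) :
    1 / 2 / ((1 + √2) ^ 2) ^ N * (c ⬝ᵥ c) ≤ c ⬝ᵥ limitH N *ᵥ c := by
  obtain ⟨a, rfl⟩ : ∃ a, c = a ᵥ* coeffU N := by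
    have := Matrix.vecMul_surjective_iff_isUnit.2 (isUnit_coeffU N)
    exact (this c).imp fun a h => h.symm
  set c := a ᵥ* coeffU N with hc
  have hγ : (2 : ℝ) ≤ (1 + √2) ^ 2 := by
    have := Real.sq_sqrt (show (0 : ℝ) ≤ 2 by norm_num)
    nlinarith [Real.sqrt_nonneg 2]
  set γ : ℝ := (1 + √2) ^ 2 with hγ_def
  have hlow : Real.pi / 4 * ∑ n, a n ^ 2 ≤ c ⬝ᵥ limitH N *ᵥ c := by
    rw [dotProduct_limitH_mulVec]
    have h := integral_comp_cos_mul_sin_sq_le (f := fun x => ∑ k, c k * x ^ (k : ℕ)) (by fun_prop)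
    have e : ∀ θ : ℝ, (∑ k, c k * Real.cos θ ^ (k : ℕ)) * Real.sin θ
        = ∑ n : Fin N, a n * Real.sin (((n : ℕ) + 1 : ℝ) * θ) := by
      intro θ
      have e1 : ∑ k, c k * Real.cos θ ^ (k : ℕ)
          = ∑ n : Fin N, a n * (U ℝ (n : ℕ)).eval (Real.cos θ) := by
        simp only [eval_U_eq_sum, hc, vecMul, dotProduct, Finset.sum_mul, Finset.mul_sum]
        rw [Finset.sum_comm]
        exact Finset.sum_congr rfl fun n _ => Finset.sum_congr rfl fun m _ => by ring
      rw [e1, Finset.sum_mul]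
      refine Finset.sum_congr rfl fun n _ => ?_
      have := U_real_cos θ (n : ℕ)
      push_cast at this
      rw [mul_assoc, this]
    simp only [e, integral_sq_sum_sin] at h
    linarith
  have hup : c ⬝ᵥ c ≤ γ ^ N * ∑ n, a n ^ 2 := by
    have h1 : ∀ k, c k * c k ≤ (∑ n, a n ^ 2) * ∑ n, coeffU N n k ^ 2 := by
      intro k
      rw [← sq]
      exact Finset.sum_mul_sq_le_sq_mul_sq Finset.univ a fun n => coeffU N n k
    have h2 : ∀ n : Fin N, ∑ k, coeffU N n k ^ 2 ≤ γ ^ (n : ℕ) := by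
      intro n
      have := sum_sq_coeff_U_le n N
      rwa [← Fin.sum_univ_eq_sum_range (fun k => (U ℝ ((n : ℕ) : ℤ)).coeff k ^ 2)] at this
    -- The sum is (γ^N - 1)/(γ - 1), and γ ≥ 2.
    have h3 : ∑ n : Fin N, γ ^ (n : ℕ) ≤ γ ^ N := by
      rw [Fin.sum_univ_eq_sum_range (fun k => γ ^ k), geom_sum_eq (by linarith)]
      rw [div_le_iff₀ (by linarith)]
      have : 0 < γ ^ N := by positivity
      nlinarith
    have h0 : 0 ≤ ∑ n, a n ^ 2 := Finset.sum_nonneg fun _ _ => sq_nonneg _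
    calc c ⬝ᵥ c ≤ ∑ k, (∑ n, a n ^ 2) * ∑ n, coeffU N n k ^ 2 := Finset.sum_le_sum fun k _ => h1 k
      _ = (∑ n, a n ^ 2) * ∑ n, ∑ k, coeffU N n k ^ 2 := by
        rw [← Finset.mul_sum, Finset.sum_comm]
      _ ≤ (∑ n, a n ^ 2) * γ ^ N := by
        gcongr
        exact (Finset.sum_le_sum fun n _ => h2 n).trans h3
      _ = _ := mul_comm _ _
  have hγN : 0 < γ ^ N := by positivity
  have h0 : 0 ≤ ∑ n, a n ^ 2 := Finset.sum_nonneg fun _ _ => sq_nonneg _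
  calc 1 / 2 / γ ^ N * (c ⬝ᵥ c) ≤ 1 / 2 / γ ^ N * (γ ^ N * ∑ n, a n ^ 2) := by gcongr
    _ = 1 / 2 * ∑ n, a n ^ 2 := by field_simp
    _ ≤ Real.pi / 4 * ∑ n, a n ^ 2 := by
      exact mul_le_mul_of_nonneg_right (by linarith [Real.pi_gt_three]) h0
    _ ≤ _ := hlow

end EDMD

namespace EDMD

open MeasureTheory

/-! ## Quadrature for functions of bounded variation -/

/-- The increments of `f` on `[-1, 1]` are dominated by those of `v`. -/
def IncrementBound (f v : ℝ → ℝ) : Prop :=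
  ∀ x ∈ Set.Icc (-1 : ℝ) 1, ∀ y ∈ Set.Icc (-1 : ℝ) 1, x ≤ y → |f y - f x| ≤ v y - v x

namespace IncrementBound

variable {f g v w : ℝ → ℝ}

theorem monotoneOn (h : IncrementBound f v) : MonotoneOn v (Set.Icc (-1) 1) := fun x hx y hy hxy =>
  sub_nonneg.1 ((abs_nonneg _).trans (h x hx y hy hxy))

theorem abs_sub_le (h : IncrementBound f v) {a b x y : ℝ} (ha : a ∈ Set.Icc (-1 : ℝ) 1)
    (hb : b ∈ Set.Icc (-1 : ℝ) 1) (hx : x ∈ Set.Icc a b) (hy : y ∈ Set.Icc a b) :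
    |f x - f y| ≤ v b - v a := by
  have hx' : x ∈ Set.Icc (-1 : ℝ) 1 := ⟨ha.1.trans hx.1, hx.2.trans hb.2⟩
  have hy' : y ∈ Set.Icc (-1 : ℝ) 1 := ⟨ha.1.trans hy.1, hy.2.trans hb.2⟩
  have e1 := h.monotoneOn ha hx' hx.1
  have e2 := h.monotoneOn ha hy' hy.1
  have e3 := h.monotoneOn hx' hb hx.2
  have e4 := h.monotoneOn hy' hb hy.2
  rcases le_total x y with hxy | hxy
  · rw [abs_sub_comm]
    linarith [h x hx' y hy' hxy]
  · linarith [h y hy' x hx' hxy]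

theorem intervalIntegrable (h : IncrementBound f v) {a b : ℝ} (ha : a ∈ Set.Icc (-1 : ℝ) 1)
    (hb : b ∈ Set.Icc (-1 : ℝ) 1) : IntervalIntegrable f volume a b := by
  have hsub : Set.uIcc a b ⊆ Set.Icc (-1) 1 := Set.uIcc_subset_Icc ha hb
  have h1 : IntervalIntegrable v volume a b := (h.monotoneOn.mono hsub).intervalIntegrable
  have h2 : MonotoneOn (fun x => v x - f x) (Set.Icc (-1) 1) := by
    intro x hx y hy hxy
    have := (abs_le.1 (h x hx y hy hxy)).2
    dsimp only
    linarith
  have h3 := (h2.mono hsub).intervalIntegrable (μ := volume)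
  simpa using h1.sub h3

theorem id : IncrementBound (fun x => x) (fun x => x) := fun x _ y _ hxy => by
  rw [abs_of_nonneg (sub_nonneg.2 hxy)]

theorem mul (hf : IncrementBound f v) (hg : IncrementBound g w)
    (hf1 : ∀ x ∈ Set.Icc (-1 : ℝ) 1, |f x| ≤ 1) (hg1 : ∀ x ∈ Set.Icc (-1 : ℝ) 1, |g x| ≤ 1) :
    IncrementBound (fun x => f x * g x) (fun x => v x + w x) := fun x hx y hy hxy => by
  have e : f y * g y - f x * g x = (f y - f x) * g y + f x * (g y - g x) := by ring
  have h1 : |f y - f x| * |g y| ≤ |f y - f x| := mul_le_of_le_one_right (abs_nonneg _) (hg1 y hy)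
  have h2 : |f x| * |g y - g x| ≤ |g y - g x| := mul_le_of_le_one_left (abs_nonneg _) (hf1 x hx)
  calc |f y * g y - f x * g x| ≤ |(f y - f x) * g y| + |f x * (g y - g x)| := by
        rw [e]; exact abs_add_le _ _
    _ ≤ |f y - f x| + |g y - g x| := by rw [abs_mul, abs_mul]; exact add_le_add h1 h2
    _ ≤ _ := by linarith [hf x hx y hy hxy, hg x hx y hy hxy]

theorem pow (hf : IncrementBound f v) (hf1 : ∀ x ∈ Set.Icc (-1 : ℝ) 1, |f x| ≤ 1) (k : ℕ) :
    IncrementBound (fun x => f x ^ k) (fun x => k * v x) := by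
  induction k with
  | zero => intro x _ y _ _; simp
  | succ k ih =>
    have := ih.mul hf (fun x hx => by
      rw [abs_pow]; exact pow_le_one₀ (abs_nonneg _) (hf1 x hx)) hf1
    have e : (fun x => ((k + 1 : ℕ) : ℝ) * v x) = fun x => k * v x + v x := by
      ext x; push_cast; ring
    rwa [e]

end IncrementBound

theorem node_mem_Icc {M m : ℕ} {δ : ℝ} (hδ : 0 ≤ δ) (hδ' : δ ≤ 2 / (M : ℝ)) :
    node M δ m ∈ Set.Icc (-1 + 2 * (m : ℝ) / M) (-1 + 2 * ((m + 1 : ℕ) : ℝ) / M) := by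
  have e : 2 * ((m + 1 : ℕ) : ℝ) / M = 2 * (m : ℝ) / M + 2 / M := by push_cast; ring
  constructor
  · simp only [node]; linarith
  · rw [e]; simp only [node]; linarith

/-- Cut [-1,1] into M cells of length 2/M. For every admissible δ the m-th node lies in the m-th
closed cell, where f oscillates by at most the increment of v; these increments telescope. -/
theorem abs_node_mean_sub_integral_le {f v : ℝ → ℝ} (h : IncrementBound f v) {M : ℕ} (hM : 0 < M)
    {δ : ℝ} (hδ : 0 ≤ δ) (hδ' : δ ≤ 2 / (M : ℝ)) :
    |1 / (M : ℝ) * ∑ m ∈ Finset.range M, f (node M δ m) - 1 / 2 * ∫ x in (-1 : ℝ)..1, f x|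
      ≤ (v 1 - v (-1)) / M := by
  have hM' : (0 : ℝ) < M := by exact_mod_cast hM
  set t : ℕ → ℝ := fun m => -1 + 2 * (m : ℝ) / M with ht
  have htmono : ∀ m, t m ≤ t (m + 1) := fun m => by
    simp only [ht]; push_cast; gcongr; linarith
  have htmem : ∀ m ≤ M, t m ∈ Set.Icc (-1 : ℝ) 1 := fun m hm => by
    have hm' : (m : ℝ) ≤ M := by exact_mod_cast hm
    constructor
    · simp only [ht]
      have : 0 ≤ 2 * (m : ℝ) / M := by positivity
      linarith
    · have : 2 * (m : ℝ) / M ≤ 2 := by rw [div_le_iff₀ hM']; linarith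
      simp only [ht]
      linarith
  have ht0 : t 0 = -1 := by simp [ht]
  have htM : t M = 1 := by simp only [ht]; field_simp; norm_num
  have hlen : ∀ m, t (m + 1) - t m = 2 / M := fun m => by simp only [ht]; push_cast; ring
  have hint : ∑ m ∈ Finset.range M, ∫ x in t m..t (m + 1), f x = ∫ x in (-1 : ℝ)..1, f x := by
    rw [intervalIntegral.sum_integral_adjacent_intervals, ht0, htM]
    exact fun m hm => h.intervalIntegrable (htmem m hm.le) (htmem (m + 1) hm)
  have hpiece : ∀ m ∈ Finset.range M,
      |1 / (M : ℝ) * f (node M δ m) - 1 / 2 * ∫ x in t m..t (m + 1), f x|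
        ≤ (v (t (m + 1)) - v (t m)) / M := by
    intro m hm
    have hm' := Finset.mem_range.1 hm
    have hi := h.intervalIntegrable (htmem m hm'.le) (htmem (m + 1) hm')
    have e : 1 / (M : ℝ) * f (node M δ m) - 1 / 2 * ∫ x in t m..t (m + 1), f x
        = 1 / 2 * ∫ x in t m..t (m + 1), (f (node M δ m) - f x) := by
      rw [intervalIntegral.integral_sub (by simp) hi, intervalIntegral.integral_const, hlen,
        smul_eq_mul]
      ring
    rw [e, abs_mul]
    have := intervalIntegral.norm_integral_le_of_norm_le_const (a := t m) (b := t (m + 1))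
      (f := fun x => f (node M δ m) - f x) (C := v (t (m + 1)) - v (t m)) (fun x hx => by
        rw [Set.uIoc_of_le (htmono m)] at hx
        exact h.abs_sub_le (htmem m hm'.le) (htmem (m + 1) hm') (node_mem_Icc hδ hδ')
          (Set.Ioc_subset_Icc_self hx))
    rw [hlen, Real.norm_eq_abs, abs_of_pos (show (0 : ℝ) < 2 / M by positivity)] at this
    calc |(1 / 2 : ℝ)| * |∫ x in t m..t (m + 1), (f (node M δ m) - f x)|
        ≤ |(1 / 2 : ℝ)| * ((v (t (m + 1)) - v (t m)) * (2 / M)) := by gcongr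
      _ = _ := by rw [abs_of_pos (by norm_num)]; ring
  calc _ = |∑ m ∈ Finset.range M,
        (1 / (M : ℝ) * f (node M δ m) - 1 / 2 * ∫ x in t m..t (m + 1), f x)| := by
        rw [← hint, Finset.sum_sub_distrib, Finset.mul_sum, Finset.mul_sum]
    _ ≤ ∑ m ∈ Finset.range M, (v (t (m + 1)) - v (t m)) / M :=
        (Finset.abs_sum_le_sum_abs _ _).trans (Finset.sum_le_sum hpiece)
    _ = _ := by
        rw [← Finset.sum_div, Finset.sum_range_sub (fun m => v (t m)), ht0, htM]

theorem incrementBound_pow_mul_pow {T v : ℝ → ℝ} (hv : IncrementBound T v)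
    (hT : Set.MapsTo T (Set.Icc (-1) 1) (Set.Icc (-1) 1)) (k l : ℕ) :
    IncrementBound (fun x => T x ^ k * x ^ l) (fun x => k * v x + l * x) := by
  have h1 : ∀ x ∈ Set.Icc (-1 : ℝ) 1, |T x| ≤ 1 := fun x hx => abs_le.2 (hT hx)
  have h2 : ∀ x ∈ Set.Icc (-1 : ℝ) 1, |x| ≤ 1 := fun x hx => abs_le.2 hx
  exact (hv.pow h1 k).mul (IncrementBound.id.pow h2 l)
    (fun x hx => by rw [abs_pow]; exact pow_le_one₀ (abs_nonneg _) (h1 x hx))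
    (fun x hx => by rw [abs_pow]; exact pow_le_one₀ (abs_nonneg _) (h2 x hx))

theorem abs_nodeG_sub_limitG_le {T v : ℝ → ℝ} (hv : IncrementBound T v)
    (hT : Set.MapsTo T (Set.Icc (-1) 1) (Set.Icc (-1) 1)) {N M : ℕ} (hM : 0 < M)
    {δ : ℝ} (hδ : 0 ≤ δ) (hδ' : δ ≤ 2 / (M : ℝ)) (k l : Fin N) :
    |(nodeG T N M δ - limitG T N) k l| ≤ (v 1 - v (-1) + 2) * N / M := by
  have h := abs_node_mean_sub_integral_le (incrementBound_pow_mul_pow hv hT k l) hM hδ hδ'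
  have hk : ((k : ℕ) : ℝ) ≤ N := by exact_mod_cast k.2.le
  have hl : ((l : ℕ) : ℝ) ≤ N := by exact_mod_cast l.2.le
  have hv0 : 0 ≤ v 1 - v (-1) :=
    sub_nonneg.2 (hv.monotoneOn (by simp) (by simp) (by norm_num))
  refine h.trans (div_le_div_of_nonneg_right ?_ (by positivity))
  have := mul_le_mul_of_nonneg_right hk hv0
  linarith

theorem abs_nodeH_sub_limitH_le {N M : ℕ} (hM : 0 < M)
    {δ : ℝ} (hδ : 0 ≤ δ) (hδ' : δ ≤ 2 / (M : ℝ)) (k l : Fin N) :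
    |(nodeH N M δ - limitH N) k l| ≤ 4 * N / M := by
  -- H is G for the identity map, whose total variation 2 gives the constant 2 + 2 = 4.
  have := abs_nodeG_sub_limitG_le IncrementBound.id (fun _ h => h) hM hδ hδ' k l
  norm_num at this
  exact this

end EDMD

namespace EDMD

/-! ## Full branch maps: shape of the branches and bounded variation -/

/-- A continuous injection of an interval is strictly monotone. The image of the open branch is
open, hence inside (-1,1). It is also an interval, and the two arbitrary endpoint values cannot
account for density in any subinterval, so it fills (-1,1). -/
theorem IsAnalyticFullBranchMap.exists_branch {T : ℝ → ℝ} {d : ℕ} {I : Fin d → Set ℝ}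
    (hT : IsAnalyticFullBranchMap T d I) (l : Fin d) :
    ∃ a b : ℝ, a < b ∧ I l = Set.Icc a b ∧ -1 ≤ a ∧ b ≤ 1 ∧
      (StrictMonoOn T (Set.Ioo a b) ∨ StrictAntiOn T (Set.Ioo a b)) ∧
      T '' Set.Ioo a b = Set.Ioo (-1) 1 := by
  obtain ⟨a, b, hI⟩ := hT.isClosedInterval l
  have hfull := hT.full l
  have hab : a < b := by
    by_contra! hba
    have hfin : (T '' I l).Finite := by
      rw [hI]
      exact (Set.Subsingleton.finite (Set.subsingleton_Icc_of_ge hba)).image T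
    rw [hfin.isClosed.closure_eq] at hfull
    exact Set.Icc_infinite (show (-1 : ℝ) < 1 by norm_num) (hfull ▸ hfin)
  have hsub : Set.Icc a b ⊆ Set.Icc (-1) 1 := by
    rw [← hI, ← hT.cover]
    exact Set.subset_iUnion I l
  obtain ⟨ha, hb⟩ := (Set.Icc_subset_Icc_iff hab.le).1 hsub
  have hdiff := hT.diffeo l
  rw [hI, interior_Icc] at hdiff
  obtain ⟨hopen, han, g, -, hg⟩ := hdiff
  have hcont : ContinuousOn T (Set.Ioo a b) := han.continuousOn
  refine ⟨a, b, hab, hI, ha, hb, hcont.strictMonoOn_of_injOn_Ioo hab hg.injOn, ?_⟩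
  apply Set.Subset.antisymm
  · have h1 : T '' Set.Ioo a b ⊆ Set.Icc (-1) 1 := by
      rintro _ ⟨x, hx, rfl⟩
      exact hT.mapsTo (hsub (Set.Ioo_subset_Icc_self hx))
    exact interior_Icc (a := (-1 : ℝ)) (b := 1) ▸ interior_maximal h1 (by simpa using hopen)
  · have hoc : (T '' Set.Ioo a b).OrdConnected :=
      (isPreconnected_Ioo.image T hcont).ordConnected
    have hcl : Set.Icc (-1) 1 ⊆ closure (T '' Set.Ioo a b) ∪ {T a, T b} := by
      have hfin : ({T a, T b} : Set ℝ).Finite := by simp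
      rw [← hfull, hI, ← hfin.isClosed.closure_eq, ← closure_union]
      refine closure_mono ?_
      rintro _ ⟨x, hx, rfl⟩
      rcases eq_or_ne x a with rfl | hxa
      · simp
      rcases eq_or_ne x b with rfl | hxb
      · simp
      exact Or.inl ⟨x, ⟨lt_of_le_of_ne hx.1 hxa.symm, lt_of_le_of_ne hx.2 hxb⟩, rfl⟩
    have key : ∀ p q : ℝ, p < q → Set.Ioo p q ⊆ Set.Icc (-1) 1 →
        ∃ z ∈ T '' Set.Ioo a b, z ∈ Set.Ioo p q := by
      intro p q hpq hsub'
      obtain ⟨y, hy, hy'⟩ := (Set.Ioo_infinite hpq).exists_notMem_finite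
        (show ({T a, T b} : Set ℝ).Finite by simp)
      have hyc := (hcl (hsub' hy)).resolve_right hy'
      obtain ⟨z, hz, hz'⟩ := mem_closure_iff.1 hyc _ isOpen_Ioo hy
      exact ⟨z, hz', hz⟩
    intro y hy
    obtain ⟨z1, hz1, hz1'⟩ := key (-1) y hy.1 fun z hz => ⟨hz.1.le, (hz.2.trans hy.2).le⟩
    obtain ⟨z2, hz2, hz2'⟩ := key y 1 hy.2 fun z hz => ⟨(hy.1.trans hz.1).le, hz.2.le⟩
    exact hoc.out hz1 hz2 ⟨hz1'.2.le, hz2'.1.le⟩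

/-- A monotone function with jumps at `a`, detecting whether `a ∈ [x, y]`. -/
noncomputable def jump (a x : ℝ) : ℝ := (if a ≤ x then 2 else 0) + if a < x then 2 else 0

theorem monotone_jump (a : ℝ) : Monotone (jump a) := by
  intro x y hxy
  unfold jump
  grind

/-- If x < a the first summand jumps; if x = a the second does. The height 2 is the diameter of
[-1,1]. -/
theorem two_le_jump_sub_jump {a x y : ℝ} (hxy : x < y) (hx : x ≤ a) (hy : a ≤ y) :
    2 ≤ jump a y - jump a x := by
  unfold jump
  grind

theorem exists_monotone_abs_sub_eq {T : ℝ → ℝ} {a b : ℝ}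
    (hT : Set.MapsTo T (Set.Ioo a b) (Set.Icc (-1) 1))
    (h : StrictMonoOn T (Set.Ioo a b) ∨ StrictAntiOn T (Set.Ioo a b)) :
    ∃ g : ℝ → ℝ, Monotone g ∧ ∀ x ∈ Set.Ioo a b, ∀ y ∈ Set.Ioo a b, x ≤ y →
      |T y - T x| = g y - g x := by
  rcases h with h | h
  · obtain ⟨g, hg, hgT⟩ := h.monotoneOn.exists_monotone_extension
      (bddBelow_Icc.mono hT.image_subset) (bddAbove_Icc.mono hT.image_subset)
    refine ⟨g, hg, fun x hx y hy hxy => ?_⟩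
    rw [hgT hx, hgT hy, abs_of_nonneg (sub_nonneg.2 (hg hxy))]
  · have hT' : Set.MapsTo (fun x => -T x) (Set.Ioo a b) (Set.Icc (-1) 1) := fun x hx => by
      have := hT hx
      exact ⟨by linarith [this.2], by linarith [this.1]⟩
    obtain ⟨g, hg, hgT⟩ := h.antitoneOn.neg.exists_monotone_extension
      (bddBelow_Icc.mono hT'.image_subset) (bddAbove_Icc.mono hT'.image_subset)
    refine ⟨g, hg, fun x hx y hy hxy => ?_⟩
    have h1 := hgT hx
    have h2 := hgT hy
    simp only at h1 h2
    rw [← h1, ← h2, abs_sub_comm, abs_of_nonneg]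
    · ring
    · have := hg hxy
      linarith

/-- If [x,y] meets an endpoint of a branch, the jump there already dominates |T y - T x| ≤ 2,
whatever T does at the endpoint. Otherwise x and y lie in one open branch, where T is monotone. -/
theorem IsAnalyticFullBranchMap.exists_incrementBound {T : ℝ → ℝ} {d : ℕ} {I : Fin d → Set ℝ}
    (hT : IsAnalyticFullBranchMap T d I) : ∃ v, IncrementBound T v := by
  choose a b hab hI ha hb hmono himg using hT.exists_branch
  have hmaps : ∀ l, Set.MapsTo T (Set.Ioo (a l) (b l)) (Set.Icc (-1) 1) := fun l x hx =>
    hT.mapsTo ⟨(ha l).trans hx.1.le, hx.2.le.trans (hb l)⟩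
  choose g hg hgT using fun l => exists_monotone_abs_sub_eq (hmaps l) (hmono l)
  have hnn : ∀ {x y : ℝ}, x ≤ y → ∀ l ∈ Finset.univ,
      0 ≤ (jump (a l) y + jump (b l) y + g l y) - (jump (a l) x + jump (b l) x + g l x) := by
    intro x y hxy l _
    linarith [monotone_jump (a l) hxy, monotone_jump (b l) hxy, hg l hxy]
  refine ⟨fun x => ∑ l, (jump (a l) x + jump (b l) x + g l x), fun x hx y hy hxy => ?_⟩
  rw [← Finset.sum_sub_distrib]
  rcases hxy.eq_or_lt with rfl | hlt
  · simp
  have h2 : |T y - T x| ≤ 2 := by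
    have h1 := hT.mapsTo hx
    have h2 := hT.mapsTo hy
    rw [abs_le]
    constructor <;> linarith [h1.1, h1.2, h2.1, h2.2]
  by_cases hend : ∃ l, (x ≤ a l ∧ a l ≤ y) ∨ (x ≤ b l ∧ b l ≤ y)
  · obtain ⟨l, hl⟩ := hend
    refine h2.trans (le_trans ?_ (Finset.single_le_sum (hnn hxy) (Finset.mem_univ l)))
    have e1 := monotone_jump (a l) hxy
    have e2 := monotone_jump (b l) hxy
    have e3 := hg l hxy
    rcases hl with hl | hl
    · linarith [two_le_jump_sub_jump hlt hl.1 hl.2]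
    · linarith [two_le_jump_sub_jump hlt hl.1 hl.2]
  · push Not at hend
    rw [← hT.cover] at hx
    obtain ⟨l, hl⟩ := Set.mem_iUnion.1 hx
    rw [hI] at hl
    have h1 : a l < x := by
      by_contra! h
      exact absurd ((hend l).1 h) (by linarith [hl.1])
    have h3 : y < b l := (hend l).2 hl.2
    rw [hgT l x ⟨h1, hlt.trans h3⟩ y ⟨h1.trans hlt, h3⟩ hxy]
    refine le_trans ?_ (Finset.single_le_sum (hnn hxy) (Finset.mem_univ l))
    linarith [monotone_jump (a l) hxy, monotone_jump (b l) hxy]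

end EDMD

namespace EDMD

open MeasureTheory

/-! ## The transfer operator on monomials -/

theorem integral_eq_sum_integral_branch {ι : Type*} [Fintype ι] {a b : ι → ℝ} {f : ℝ → ℝ}
    (hdisj : Pairwise fun l l' => Disjoint (Set.Ioo (a l) (b l)) (Set.Ioo (a l') (b l')))
    (hcover : ⋃ l, Set.Icc (a l) (b l) = Set.Icc (-1) 1)
    (hf : IntervalIntegrable f volume (-1) 1) :
    ∫ x in (-1 : ℝ)..1, f x = ∑ l, ∫ x in Set.Ioo (a l) (b l), f x := by
  have hfI : IntegrableOn f (Set.Icc (-1) 1) :=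
    (intervalIntegrable_iff_integrableOn_Icc_of_le (by norm_num)).1 hf
  rw [intervalIntegral.integral_of_le (by norm_num), ← integral_Icc_eq_integral_Ioc, ← hcover,
    ← integral_iUnion_fintype (fun l => measurableSet_Ioo) hdisj
      (fun l => hfI.mono_set (hcover ▸ Set.Ioo_subset_Icc_self.trans
        (Set.subset_iUnion (fun l => Set.Icc (a l) (b l)) l)))]
  exact setIntegral_congr_set
    (Filter.EventuallyEq.countable_iUnion fun l => Ioo_ae_eq_Icc.symm)

/-- Change of variables x = φ(y). The orientation sign ε = ±1 gives |φ'| = ε φ' on the interval, so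
the density stays the restriction of a holomorphic function. -/
theorem IsInverseBranchExtension.exists_integral_eq {T : ℝ → ℝ} {J : Set ℝ} {r R : ℝ} {φ : ℂ → ℂ}
    (hφ : IsInverseBranchExtension T J r R φ) (hR : 1 < R) {a b : ℝ} (hJ : J = Set.Icc a b)
    (hmono : StrictMonoOn T (Set.Ioo a b) ∨ StrictAntiOn T (Set.Ioo a b))
    (himg : T '' Set.Ioo a b = Set.Ioo (-1) 1) :
    ∃ ε : ℂ, ‖ε‖ = 1 ∧ ∀ k n : ℕ, ∫ x in Set.Ioo a b, T x ^ k * x ^ n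
      = ∫ y in Set.Ioo (-1 : ℝ) 1, y ^ k * (ε * (φ y ^ n * deriv φ y)).re := by
  have hinv : ∀ x ∈ Set.Ioo a b, φ ((T x : ℝ) : ℂ) = (x : ℂ) := fun x hx =>
    hφ.leftInv x (by rw [hJ, interior_Icc]; exact hx)
  set ψ : ℝ → ℝ := fun y => (φ (y : ℂ)).re with hψ
  have hψT : ∀ x ∈ Set.Ioo a b, ψ (T x) = x := fun x hx => by simp [hψ, hinv x hx]
  have hψimg : ψ '' Set.Ioo (-1) 1 = Set.Ioo a b := by
    rw [← himg, Set.image_image]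
    exact (Set.image_congr hψT).trans (Set.image_id' _)
  have hTψ : ∀ y ∈ Set.Ioo (-1 : ℝ) 1, T (ψ y) = y := by
    rw [← himg]
    rintro _ ⟨x, hx, rfl⟩
    rw [hψT x hx]
  have hφψ : ∀ y ∈ Set.Ioo (-1 : ℝ) 1, φ (y : ℂ) = (ψ y : ℂ) := by
    rw [← himg]
    rintro _ ⟨x, hx, rfl⟩
    rw [hψT x hx, hinv x hx]
  have hderiv : ∀ y ∈ Set.Ioo (-1 : ℝ) 1,
      HasDerivWithinAt ψ (deriv φ (y : ℂ)).re (Set.Ioo (-1) 1) y := fun y hy => by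
    have hyR : (y : ℂ) ∈ Metric.ball (0 : ℂ) R := by
      rw [mem_ball_zero_iff, Complex.norm_real, Real.norm_eq_abs]
      exact (abs_lt.2 hy).trans hR
    exact ((hφ.holomorphic.differentiableAt
      (Metric.isOpen_ball.mem_nhds hyR)).hasDerivAt.real_of_complex).hasDerivWithinAt
  rcases hmono with h | h
  · have hψm : MonotoneOn ψ (Set.Ioo (-1) 1) := by
      rw [← himg]
      rintro _ ⟨x, hx, rfl⟩ _ ⟨y, hy, rfl⟩ hxy
      rw [hψT x hx, hψT y hy]
      exact (h.le_iff_le hx hy).1 hxy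
    refine ⟨1, by simp, fun k n => ?_⟩
    rw [← hψimg, integral_image_eq_integral_deriv_smul_of_monotoneOn measurableSet_Ioo hderiv hψm]
    refine setIntegral_congr_fun measurableSet_Ioo fun y hy => ?_
    simp only [hTψ y hy, hφψ y hy, one_mul, ← Complex.ofReal_pow, Complex.re_ofReal_mul,
      smul_eq_mul]
    ring
  · have hψm : AntitoneOn ψ (Set.Ioo (-1) 1) := by
      rw [← himg]
      rintro _ ⟨x, hx, rfl⟩ _ ⟨y, hy, rfl⟩ hxy
      rw [hψT x hx, hψT y hy]
      exact (h.le_iff_ge hx hy).1 hxy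
    refine ⟨-1, by simp, fun k n => ?_⟩
    rw [← hψimg, integral_image_eq_integral_deriv_smul_of_antitoneOn measurableSet_Ioo hderiv hψm]
    refine setIntegral_congr_fun measurableSet_Ioo fun y hy => ?_
    simp only [hTψ y hy, hφψ y hy, neg_mul, one_mul, ← Complex.ofReal_pow, Complex.neg_re,
      Complex.re_ofReal_mul, smul_eq_mul]
    ring

/-- F = ∑ ε φ^n φ' is the transfer operator applied to x^n. The factor r^n comes from |φ| < r; φ' is
bounded by Cauchy's estimate on discs of radius (R-q)/2, which stay inside D_R. -/
theorem exists_holomorphic_integral_eq {T : ℝ → ℝ} {d : ℕ} {I : Fin d → Set ℝ}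
    (hT : IsAnalyticFullBranchMap T d I) {r R q : ℝ} (hr : 0 < r) (hq : 1 < q) (hqR : q < R)
    {φ : Fin d → ℂ → ℂ} (hφ : ∀ l, IsInverseBranchExtension T (I l) r R (φ l)) :
    ∃ B : ℝ, 0 ≤ B ∧ ∀ n : ℕ, ∃ F : ℂ → ℂ, DifferentiableOn ℂ F (Metric.ball 0 R) ∧
      (∀ z ∈ Metric.sphere (0 : ℂ) q, ‖F z‖ ≤ B * r ^ n) ∧
      ∀ k : ℕ, ∫ x in (-1 : ℝ)..1, T x ^ k * x ^ n = ∫ y in (-1 : ℝ)..1, y ^ k * (F y).re := by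
  have hR : 1 < R := hq.trans hqR
  choose a b hab hI ha hb hmono himg using hT.exists_branch
  choose ε hε hint using fun l => (hφ l).exists_integral_eq hR (hI l) (hmono l) (himg l)
  have hderivdiff : ∀ l, DifferentiableOn ℂ (deriv (φ l)) (Metric.ball 0 R) := fun l =>
    (hφ l).holomorphic.deriv Metric.isOpen_ball
  set s : ℝ := (R - q) / 2 with hs
  have hs0 : 0 < s := by rw [hs]; linarith
  have hderivbound : ∀ l, ∀ z ∈ Metric.sphere (0 : ℂ) q, ‖deriv (φ l) z‖ ≤ r / s := by
    intro l z hz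
    have hsub : Metric.closedBall z s ⊆ Metric.ball 0 R := by
      refine Metric.closedBall_subset_ball' ?_
      rw [Metric.mem_sphere.1 hz, hs]; linarith
    refine Complex.norm_deriv_le_of_forall_mem_sphere_norm_le hs0
      (((hφ l).holomorphic.mono hsub).diffContOnCl_ball subset_rfl) fun w hw => ?_
    exact (mem_ball_zero_iff.1
      ((hφ l).mapsTo_disk (hsub (Metric.sphere_subset_closedBall hw)))).le
  have hterm : ∀ l (n : ℕ), DifferentiableOn ℂ
      (fun z => ε l * (φ l z ^ n * deriv (φ l) z)) (Metric.ball 0 R) := fun l n =>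
    (((hφ l).holomorphic.pow n).mul (hderivdiff l)).const_mul _
  refine ⟨d * (r / s), by positivity, fun n =>
    ⟨fun z => ∑ l, ε l * (φ l z ^ n * deriv (φ l) z), ?_, ?_, fun k => ?_⟩⟩
  · exact DifferentiableOn.fun_sum fun l _ => hterm l n
  · intro z hz
    calc ‖∑ l, ε l * (φ l z ^ n * deriv (φ l) z)‖ ≤ ∑ _l : Fin d, r ^ n * (r / s) := by
          refine norm_sum_le_of_le _ fun l _ => ?_
          rw [norm_mul, norm_mul, norm_pow, hε, one_mul]
          have hzR : z ∈ Metric.ball (0 : ℂ) R := by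
            rw [mem_ball_zero_iff, mem_sphere_zero_iff_norm.1 hz]; exact hqR
          have h1 : ‖φ l z‖ ≤ r := (mem_ball_zero_iff.1 ((hφ l).mapsTo_disk hzR)).le
          have h2 := hderivbound l z hz
          gcongr
      _ = _ := by simp; ring
  · obtain ⟨v, hv⟩ := hT.exists_incrementBound
    rw [integral_eq_sum_integral_branch (a := a) (b := b)
      (by simpa only [hI, interior_Icc] using hT.disjoint_interior)
      (by simpa only [hI] using hT.cover)
      ((incrementBound_pow_mul_pow hv hT.mapsTo k n).intervalIntegrable (by simp) (by simp))]
    have hcont : ∀ l, IntegrableOn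
        (fun y : ℝ => y ^ k * (ε l * (φ l y ^ n * deriv (φ l) y)).re) (Set.Ioo (-1) 1) := by
      intro l
      refine (ContinuousOn.integrableOn_Icc ?_).mono_set Set.Ioo_subset_Icc_self
      refine (continuousOn_id.pow k).mul (Complex.continuous_re.comp_continuousOn
        ((hterm l n).continuousOn.comp Complex.continuous_ofReal.continuousOn fun y hy => ?_))
      rw [mem_ball_zero_iff, Complex.norm_real, Real.norm_eq_abs]
      exact (abs_le.2 hy).trans_lt hR
    rw [intervalIntegral.integral_of_le (by norm_num), integral_Ioc_eq_integral_Ioo]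
    simp only [hint, Complex.re_sum, Finset.mul_sum]
    rw [integral_finsetSum _ fun l _ => hcont l]

theorem exists_taylor_bound {F : ℂ → ℂ} {q R B : ℝ} (hq : 1 < q) (hqR : q < R)
    (hF : DifferentiableOn ℂ F (Metric.ball 0 R)) (hB : ∀ z ∈ Metric.sphere (0 : ℂ) q, ‖F z‖ ≤ B) :
    ∃ a : ℕ → ℝ, (∀ n, |a n| ≤ B / q ^ n) ∧ ∀ N : ℕ, ∀ y ∈ Set.Icc (-1 : ℝ) 1,
      |(F y).re - ∑ n ∈ Finset.range N, a n * y ^ n| ≤ B / q ^ N / (1 - q⁻¹) := by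
  have hq0 : 0 < q := by linarith
  set c : ℕ → ℂ := fun n => (n.factorial : ℂ)⁻¹ * iteratedDeriv n F 0 with hc
  have hcb : ∀ n, ‖c n‖ ≤ B / q ^ n := fun n => by
    have hsub : Metric.closedBall (0 : ℂ) q ⊆ Metric.ball 0 R := Metric.closedBall_subset_ball hqR
    have := Complex.norm_iteratedDeriv_le_of_forall_mem_sphere_norm_le n hq0
      ((hF.mono hsub).diffContOnCl_ball subset_rfl) hB
    rw [hc, norm_mul, norm_inv, Complex.norm_natCast]
    have hn : (0 : ℝ) < n.factorial := by positivity
    rw [inv_mul_le_iff₀ hn]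
    calc _ ≤ _ := this
      _ = _ := by ring
  refine ⟨fun n => (c n).re, fun n => (Complex.abs_re_le_norm _).trans (hcb n),
    fun N y hy => ?_⟩
  have hy1 : ‖(y : ℂ)‖ ≤ 1 := by
    rw [Complex.norm_real, Real.norm_eq_abs]; exact abs_le.2 hy
  have hsum : HasSum (fun n => c n * (y : ℂ) ^ n) (F y) := by
    have := Complex.hasSum_taylorSeries_on_ball (f := F) hF (z := (y : ℂ))
      (mem_ball_zero_iff.2 (by linarith))
    have e : (fun n => c n * (y : ℂ) ^ n) = fun n : ℕ =>
        (n.factorial : ℂ)⁻¹ • ((y : ℂ) - 0) ^ n • iteratedDeriv n F 0 := by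
      ext n
      simp only [hc, sub_zero, smul_eq_mul]
      ring
    rwa [e]
  have hbound : ∀ n, ‖c n * (y : ℂ) ^ n‖ ≤ B * q⁻¹ ^ n := fun n => by
    rw [norm_mul, norm_pow, inv_pow, ← div_eq_mul_inv]
    exact (mul_le_of_le_one_right (norm_nonneg _) (pow_le_one₀ (norm_nonneg _) hy1)).trans (hcb n)
  have := norm_sub_le_of_geometric_bound_of_hasSum (inv_lt_one_of_one_lt₀ hq) hbound hsum N
  rw [norm_sub_rev] at this
  calc |(F y).re - ∑ n ∈ Finset.range N, (c n).re * y ^ n|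
      = |(F y - ∑ n ∈ Finset.range N, c n * (y : ℂ) ^ n).re| := by
        rw [Complex.sub_re, Complex.re_sum]
        simp only [← Complex.ofReal_pow, Complex.re_mul_ofReal]
    _ ≤ _ := (Complex.abs_re_le_norm _).trans this
    _ = _ := by rw [inv_pow, div_eq_mul_inv B]

/-- Replace F by its Taylor polynomial of degree below N: the moments of the polynomial are H
applied to its coefficients a, and e collects the moments of the remainder. -/
theorem exists_limitG_column {T : ℝ → ℝ} {d : ℕ} {I : Fin d → Set ℝ}
    (hT : IsAnalyticFullBranchMap T d I) {r R q : ℝ} (hr : 0 < r) (hq : 1 < q) (hqR : q < R)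
    {φ : Fin d → ℂ → ℂ} (hφ : ∀ l, IsInverseBranchExtension T (I l) r R (φ l)) :
    ∃ B : ℝ, 0 ≤ B ∧ ∀ (N : ℕ) (l : Fin N), ∃ a e : Fin N → ℝ,
      (limitG T N).col l = (limitH N).mulVec a + e ∧
      (∀ n, |a n| ≤ B * r ^ (l : ℕ) * q⁻¹ ^ (n : ℕ)) ∧
      ∀ k, |e k| ≤ B * r ^ (l : ℕ) * q⁻¹ ^ N := by
  obtain ⟨B, hB0, hB⟩ := exists_holomorphic_integral_eq hT hr hq hqR hφ
  have hq1 : 0 < 1 - q⁻¹ := sub_pos.2 (inv_lt_one_of_one_lt₀ hq)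
  have hq1' : 1 ≤ 1 / (1 - q⁻¹) := by
    rw [le_div_iff₀ hq1]
    have : 0 < q⁻¹ := by positivity
    linarith
  refine ⟨B * (1 / (1 - q⁻¹)), by positivity, fun N l => ?_⟩
  obtain ⟨F, hF, hFB, hFint⟩ := hB l
  obtain ⟨a, ha, hrem⟩ := exists_taylor_bound hq hqR hF hFB
  have hFc : ContinuousOn (fun y : ℝ => (F y).re) (Set.uIcc (-1) 1) := by
    refine Complex.continuous_re.comp_continuousOn
      (hF.continuousOn.comp Complex.continuous_ofReal.continuousOn fun y hy => ?_)
    rw [Set.uIcc_of_le (by norm_num)] at hy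
    rw [mem_ball_zero_iff, Complex.norm_real, Real.norm_eq_abs]
    exact (abs_le.2 hy).trans_lt (hq.trans hqR)
  refine ⟨fun n => a n, fun k => 1 / 2 * ∫ y in (-1 : ℝ)..1,
    y ^ (k : ℕ) * ((F y).re - ∑ n ∈ Finset.range N, a n * y ^ n), ?_, fun n => ?_, fun k => ?_⟩
  · ext k
    simp only [Matrix.col_apply, limitG, limitH, Matrix.of_apply, hFint, Pi.add_apply,
      Matrix.mulVec, dotProduct]
    have e1 : ∀ y : ℝ, y ^ (k : ℕ) * ((F y).re - ∑ n ∈ Finset.range N, a n * y ^ n)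
        = y ^ (k : ℕ) * (F y).re - ∑ n : Fin N, a n * (y ^ (k : ℕ) * y ^ (n : ℕ)) := by
      intro y
      rw [mul_sub, ← Fin.sum_univ_eq_sum_range (fun n => a n * y ^ n), Finset.mul_sum]
      congr 1
      exact Finset.sum_congr rfl fun n _ => by ring
    simp only [e1]
    have hint : IntervalIntegrable (fun y : ℝ => y ^ (k : ℕ) * (F y).re) volume (-1) 1 :=
      ((continuousOn_id.pow _).mul hFc).intervalIntegrable
    rw [intervalIntegral.integral_sub hint
      (Continuous.intervalIntegrable (by fun_prop) _ _),
      intervalIntegral.integral_finsetSum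
        fun m _ => Continuous.intervalIntegrable (by fun_prop) _ _]
    simp only [intervalIntegral.integral_const_mul]
    rw [mul_sub, Finset.mul_sum]
    have : ∀ n : Fin N, 1 / 2 * (a n * ∫ x in (-1 : ℝ)..1, x ^ (k : ℕ) * x ^ (n : ℕ))
      = (1 / 2 * ∫ x in (-1 : ℝ)..1, x ^ (k : ℕ) * x ^ (n : ℕ)) * a n := fun n => by ring
    simp only [this]
    ring
  · refine (ha n).trans ?_
    rw [div_eq_mul_inv, inv_pow]
    have : 0 ≤ B * r ^ (l : ℕ) * (q ^ (n : ℕ))⁻¹ := by positivity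
    nlinarith
  · have h := intervalIntegral.norm_integral_le_of_norm_le_const (a := (-1 : ℝ)) (b := 1)
      (f := fun y => y ^ (k : ℕ) * ((F y).re - ∑ n ∈ Finset.range N, a n * y ^ n))
      (C := B * r ^ (l : ℕ) / q ^ N / (1 - q⁻¹)) (fun y hy => by
        rw [Set.uIoc_of_le (by norm_num)] at hy
        have hy' : y ∈ Set.Icc (-1 : ℝ) 1 := Set.Ioc_subset_Icc_self hy
        rw [Real.norm_eq_abs, abs_mul, abs_pow]
        exact (mul_le_of_le_one_left (abs_nonneg _)
          (pow_le_one₀ (abs_nonneg _) (abs_le.2 hy'))).trans (hrem N y hy'))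
    rw [Real.norm_eq_abs, show |(1 : ℝ) - -1| = 2 by norm_num] at h
    rw [abs_mul, abs_of_pos (show (0 : ℝ) < 1 / 2 by norm_num)]
    calc _ ≤ 1 / 2 * (B * r ^ (l : ℕ) / q ^ N / (1 - q⁻¹) * 2) := by gcongr
      _ = _ := by rw [inv_pow]; ring

end EDMD

namespace EDMD

open Matrix

/-! ## Coercive matrices -/

variable {N : ℕ}

theorem sqrt_dotProduct_le_sum_abs (x : Fin N → ℝ) : √(x ⬝ᵥ x) ≤ ∑ k, |x k| := by
  rw [Real.sqrt_le_left (Finset.sum_nonneg fun _ _ => abs_nonneg _)]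
  calc x ⬝ᵥ x = ∑ k, |x k| ^ 2 := by simp [dotProduct, sq]
    _ ≤ _ := Finset.sum_sq_le_sq_sum_of_nonneg fun _ _ => abs_nonneg _

theorem sq_sum_abs_le (x : Fin N → ℝ) : (∑ k, |x k|) ^ 2 ≤ N * (x ⬝ᵥ x) := by
  have := sq_sum_le_card_mul_sum_sq (s := Finset.univ) (f := fun k => |x k|)
  simpa [dotProduct, sq] using this

theorem sum_abs_le_mul_sqrt_dotProduct (x : Fin N → ℝ) : ∑ k, |x k| ≤ N * √(x ⬝ᵥ x) := by
  have hx : 0 ≤ x ⬝ᵥ x := Finset.sum_nonneg fun k _ => mul_self_nonneg _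
  refine abs_le_of_sq_le_sq' ?_ (by positivity) |>.2
  rw [mul_pow, Real.sq_sqrt hx]
  refine (sq_sum_abs_le x).trans (mul_le_mul_of_nonneg_right ?_ hx)
  exact_mod_cast Nat.le_self_pow two_ne_zero N

theorem mul_sqrt_dotProduct_le_of_coercive {A : Matrix (Fin N) (Fin N) ℝ} {κ : ℝ}
    (hA : ∀ x, κ * (x ⬝ᵥ x) ≤ x ⬝ᵥ A *ᵥ x) (x : Fin N → ℝ) :
    κ * √(x ⬝ᵥ x) ≤ √(A *ᵥ x ⬝ᵥ A *ᵥ x) := by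
  have hx : 0 ≤ x ⬝ᵥ x := Finset.sum_nonneg fun k _ => mul_self_nonneg _
  rcases hx.eq_or_lt with h0 | h0
  · rw [← h0]; simp
  have hpos := Real.sqrt_pos.2 h0
  have hcs : x ⬝ᵥ A *ᵥ x ≤ √(x ⬝ᵥ x) * √(A *ᵥ x ⬝ᵥ A *ᵥ x) := by
    have := Real.sum_mul_le_sqrt_mul_sqrt Finset.univ x (A *ᵥ x)
    simpa [dotProduct, sq] using this
  have hss := Real.mul_self_sqrt hx
  refine le_of_mul_le_mul_left ?_ hpos
  calc √(x ⬝ᵥ x) * (κ * √(x ⬝ᵥ x)) = κ * (x ⬝ᵥ x) := by rw [← hss]; simp; ring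
    _ ≤ _ := (hA x).trans hcs

theorem isUnit_of_coercive {A : Matrix (Fin N) (Fin N) ℝ} {κ : ℝ} (hκ : 0 < κ)
    (hA : ∀ x, κ * (x ⬝ᵥ x) ≤ x ⬝ᵥ A *ᵥ x) : IsUnit A := by
  rw [← Matrix.mulVec_injective_iff_isUnit]
  intro x y hxy
  have h := hA (x - y)
  rw [Matrix.mulVec_sub, show A *ᵥ x = A *ᵥ y from hxy, sub_self, dotProduct_zero] at h
  have h0 : 0 ≤ (x - y) ⬝ᵥ (x - y) := Finset.sum_nonneg fun k _ => mul_self_nonneg _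
  have : (x - y) ⬝ᵥ (x - y) = 0 := by nlinarith
  exact sub_eq_zero.1 (dotProduct_self_eq_zero.1 this)

theorem abs_mulVec_le {A : Matrix (Fin N) (Fin N) ℝ} {ε : ℝ} (hA : ∀ k l, |A k l| ≤ ε)
    (x : Fin N → ℝ) (k : Fin N) : |(A *ᵥ x) k| ≤ ε * ∑ l, |x l| := by
  rw [mulVec, dotProduct, Finset.mul_sum]
  refine (Finset.abs_sum_le_sum_abs _ _).trans (Finset.sum_le_sum fun l _ => ?_)
  rw [abs_mul]
  exact mul_le_mul_of_nonneg_right (hA k l) (abs_nonneg _)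

theorem abs_dotProduct_mulVec_le {A : Matrix (Fin N) (Fin N) ℝ} {ε : ℝ} (hε : 0 ≤ ε)
    (hA : ∀ k l, |A k l| ≤ ε) (x : Fin N → ℝ) : |x ⬝ᵥ A *ᵥ x| ≤ ε * N * (x ⬝ᵥ x) := by
  calc |x ⬝ᵥ A *ᵥ x| ≤ ∑ k, |x k| * (ε * ∑ l, |x l|) := by
        refine (Finset.abs_sum_le_sum_abs _ _).trans (Finset.sum_le_sum fun k _ => ?_)
        rw [abs_mul]
        exact mul_le_mul_of_nonneg_left (abs_mulVec_le hA x k) (abs_nonneg _)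
    _ = ε * (∑ l, |x l|) ^ 2 := by rw [← Finset.sum_mul]; ring
    _ ≤ ε * (N * (x ⬝ᵥ x)) := mul_le_mul_of_nonneg_left (sq_sum_abs_le x) hε
    _ = _ := by ring

/-- Entrywise errors 4N/M change the quadratic form by at most 4N²/M, which the constant 16 makes at
most half of the coercivity constant of `limitH`. -/
theorem nodeH_coercive {M : ℕ} {δ : ℝ} (hM : 0 < M) (hδ : 0 ≤ δ) (hδ' : δ ≤ 2 / (M : ℝ))
    (hNM : 16 * (N : ℝ) ^ 2 * ((1 + √2) ^ 2) ^ N ≤ M) (x : Fin N → ℝ) :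
    1 / 4 / ((1 + √2) ^ 2) ^ N * (x ⬝ᵥ x) ≤ x ⬝ᵥ nodeH N M δ *ᵥ x := by
  have hx : 0 ≤ x ⬝ᵥ x := Finset.sum_nonneg fun k _ => mul_self_nonneg _
  have hM' : (0 : ℝ) < M := by exact_mod_cast hM
  have h1 := limitH_coercive x
  have h2 := abs_dotProduct_mulVec_le (by positivity) (abs_nodeH_sub_limitH_le hM hδ hδ') x
  rw [sub_mulVec, dotProduct_sub] at h2
  have h3 : 4 * N / (M : ℝ) * N ≤ 1 / 4 / ((1 + √2) ^ 2) ^ N := by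
    have hg : (0 : ℝ) < ((1 + √2) ^ 2) ^ N := by positivity
    rw [div_mul_eq_mul_div, div_le_div_iff₀ hM' hg]
    linarith
  have h4 := mul_le_mul_of_nonneg_right h3 hx
  have h5 : 1 / 2 / ((1 + √2) ^ 2) ^ N * (x ⬝ᵥ x)
      = 1 / 4 / ((1 + √2) ^ 2) ^ N * (x ⬝ᵥ x) + 1 / 4 / ((1 + √2) ^ 2) ^ N * (x ⬝ᵥ x) := by ring
  linarith [(abs_le.1 h2).1]

/-! ## Norms of lifted matrices -/

theorem lift_sub (A B : Matrix (Fin N) (Fin N) ℝ) : lift (A - B) = lift A - lift B := by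
  simp [lift, sub_smul, Finset.sum_sub_distrib]

theorem inner_stdVec (k l : ℕ) : inner ℂ (stdVec k) (stdVec l) = if k = l then (1 : ℂ) else 0 := by
  rw [stdVec, lp.inner_single_left, stdVec, lp.single_apply]
  rcases eq_or_ne k l with rfl | h
  · simp
  · simp [h]

theorem matrixUnit_comp (k l k' l' : ℕ) :
    matrixUnit k l ∘L matrixUnit k' l' = if l = k' then matrixUnit k l' else 0 := by
  ext1 x
  simp only [matrixUnit, ContinuousLinearMap.comp_apply, ContinuousLinearMap.smulRight_apply,
    innerSL_apply_apply, inner_smul_right, inner_stdVec]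
  split_ifs <;> simp

theorem lift_comp (A B : Matrix (Fin N) (Fin N) ℝ) : lift A ∘L lift B = lift (A * B) := by
  simp only [lift, ContinuousLinearMap.finsetSum_comp, ContinuousLinearMap.comp_finsetSum,
    ContinuousLinearMap.smul_comp, ContinuousLinearMap.comp_smul, matrixUnit_comp, Fin.val_inj,
    Matrix.mul_apply, Complex.ofReal_sum, Complex.ofReal_mul, Finset.sum_smul, smul_ite, smul_zero]
  simp only [Finset.sum_ite_eq', Finset.mem_univ, if_true, Finset.smul_sum, smul_smul]
  rw [Finset.sum_comm, Finset.sum_comm (s := Finset.univ (α := Fin N)) (f := fun k x =>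
    ∑ i, (((A k i : ℝ) : ℂ) * ((B i x : ℝ) : ℂ)) • matrixUnit k x)]
  refine Finset.sum_congr rfl fun x _ => ?_
  rw [Finset.sum_comm]
  exact Finset.sum_congr rfl fun k _ => Finset.sum_congr rfl fun i _ => by rw [mul_comm]

theorem norm_sum_smul_stdVec (c : Fin N → ℝ) :
    ‖∑ k : Fin N, ((c k : ℝ) : ℂ) • stdVec k‖ = √(c ⬝ᵥ c) := by
  have h : ‖∑ k : Fin N, ((c k : ℝ) : ℂ) • stdVec k‖ ^ 2 = c ⬝ᵥ c := by
    have e : ((‖∑ k : Fin N, ((c k : ℝ) : ℂ) • stdVec k‖ ^ 2 : ℝ) : ℂ) = ((c ⬝ᵥ c : ℝ) : ℂ) := by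
      have := inner_self_eq_norm_sq_to_K (𝕜 := ℂ) (∑ k : Fin N, ((c k : ℝ) : ℂ) • stdVec k)
      push_cast
      refine this.symm.trans ?_
      simp only [sum_inner, inner_sum, inner_smul_left, inner_smul_right, inner_stdVec,
        Fin.val_inj, dotProduct]
      simp
    exact_mod_cast e
  rw [← h, Real.sqrt_sq (norm_nonneg _)]

theorem norm_lift_le (A : Matrix (Fin N) (Fin N) ℝ) : ‖lift A‖ ≤ ∑ l, √(A.col l ⬝ᵥ A.col l) := by
  have e : lift A = ∑ l : Fin N, ContinuousLinearMap.smulRight (innerSL ℂ (stdVec l))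
      (∑ k : Fin N, ((A k l : ℝ) : ℂ) • stdVec k) := by
    rw [lift, Finset.sum_comm]
    refine Finset.sum_congr rfl fun l _ => ?_
    ext1 x
    simp only [matrixUnit, _root_.sum_apply, _root_.smul_apply,
      ContinuousLinearMap.smulRight_apply, Finset.smul_sum]
    exact Finset.sum_congr rfl fun k _ => smul_comm _ _ _
  rw [e]
  refine norm_sum_le_of_le _ fun l _ => ?_
  have h1 : ‖stdVec l‖ = 1 := by
    rw [stdVec, lp.norm_single (by norm_num)]; simp
  rw [ContinuousLinearMap.norm_smulRight_apply, innerSL_apply_norm, h1, one_mul,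
    ← norm_sum_smul_stdVec]
  rfl

end EDMD

namespace EDMD

open Matrix

/-! ## Columns of the EDMD matrices -/

theorem geom_sum_range_le {x : ℝ} (h0 : 0 ≤ x) (h1 : x < 1) (N : ℕ) :
    ∑ k ∈ Finset.range N, x ^ k ≤ (1 - x)⁻¹ :=
  tsum_geometric_of_lt_one h0 h1 ▸
    (summable_geometric_of_lt_one h0 h1).sum_le_tsum _ fun _ _ => pow_nonneg h0 _

theorem one_half_div_pow_pos (N : ℕ) : 0 < 1 / 2 / ((1 + √2) ^ 2 : ℝ) ^ N := by positivity

theorem isUnit_limitH (N : ℕ) : IsUnit (limitH N) :=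
  isUnit_of_coercive (one_half_div_pow_pos N) limitH_coercive

theorem exists_sum_abs_limitH_inv_mul_limitG_le {T : ℝ → ℝ} {d : ℕ} {I : Fin d → Set ℝ}
    (hT : IsAnalyticFullBranchMap T d I) {r R : ℝ} (hr : 0 < r) (hR : (1 + √2) ^ 2 < R)
    {φ : Fin d → ℂ → ℂ} (hφ : ∀ l, IsInverseBranchExtension T (I l) r R (φ l)) :
    ∃ C : ℝ, 0 ≤ C ∧ ∀ (N : ℕ) (l : Fin N),
      ∑ k, |((limitH N)⁻¹ *ᵥ (limitG T N).col l) k| ≤ C * r ^ (l : ℕ) := by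
  obtain ⟨q, hγq, hqR⟩ := exists_between hR
  have hγ1 : (1 : ℝ) < (1 + √2) ^ 2 := by
    have : 0 < √2 := by positivity
    nlinarith
  set γ : ℝ := (1 + √2) ^ 2 with hγ
  have hq : 1 < q := hγ1.trans hγq
  have hq0 : 0 < q := by linarith
  obtain ⟨B, hB0, hB⟩ := exists_limitG_column hT hr hq hqR hφ
  have hγq0 : 0 ≤ γ / q := by positivity
  -- One factor N comes from summing the entries of e, the other from passing from the ℓ² to the ℓ¹
  -- norm of H⁻¹e; γ/q < 1 absorbs both.
  obtain ⟨K, hK⟩ := (tendsto_pow_const_mul_const_pow_of_lt_one 2 hγq0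
    ((div_lt_one hq0).2 hγq)).bddAbove_range
  have hKN : ∀ N : ℕ, (N : ℝ) ^ 2 * (γ / q) ^ N ≤ K := fun N => hK ⟨N, rfl⟩
  have hq1 : 0 < 1 - q⁻¹ := sub_pos.2 (inv_lt_one_of_one_lt₀ hq)
  have hK0 : 0 ≤ K := by simpa using hKN 0
  refine ⟨B * (1 - q⁻¹)⁻¹ + 2 * B * K, by positivity, fun N l => ?_⟩
  obtain ⟨a, e, hcol, ha, he⟩ := hB N l
  have hdet := (Matrix.isUnit_iff_isUnit_det _).1 (isUnit_limitH N)
  have hsplit : (limitH N)⁻¹ *ᵥ (limitG T N).col l = a + (limitH N)⁻¹ *ᵥ e := by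
    rw [hcol, mulVec_add, mulVec_mulVec, nonsing_inv_mul _ hdet, one_mulVec]
  set w := (limitH N)⁻¹ *ᵥ e with hw
  have hHw : limitH N *ᵥ w = e := by
    rw [hw, mulVec_mulVec, mul_nonsing_inv _ hdet, one_mulVec]
  have hγN : 0 < γ ^ N := by positivity
  have hsum_e : ∑ k, |e k| ≤ N * (B * r ^ (l : ℕ) * q⁻¹ ^ N) := by
    calc ∑ k, |e k| ≤ ∑ _k : Fin N, B * r ^ (l : ℕ) * q⁻¹ ^ N := Finset.sum_le_sum fun k _ => he k
      _ = _ := by simp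
  have hwe : √(w ⬝ᵥ w) ≤ 2 * γ ^ N * (N * (B * r ^ (l : ℕ) * q⁻¹ ^ N)) := by
    have h := mul_sqrt_dotProduct_le_of_coercive limitH_coercive w
    rw [hHw] at h
    have h' := (h.trans (sqrt_dotProduct_le_sum_abs e)).trans hsum_e
    rw [← hγ, div_div, one_div, inv_mul_le_iff₀ (by positivity)] at h'
    exact h'
  have hsum_w : ∑ k, |w k| ≤ 2 * B * K * r ^ (l : ℕ) := by
    calc ∑ k, |w k| ≤ N * (2 * γ ^ N * (N * (B * r ^ (l : ℕ) * q⁻¹ ^ N))) :=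
          (sum_abs_le_mul_sqrt_dotProduct w).trans (by gcongr)
      _ = 2 * B * ((N : ℝ) ^ 2 * (γ / q) ^ N) * r ^ (l : ℕ) := by
          rw [div_eq_mul_inv γ q, mul_pow γ]; ring
      _ ≤ _ := by gcongr; exact hKN N
  have hsum_a : ∑ k, |a k| ≤ B * (1 - q⁻¹)⁻¹ * r ^ (l : ℕ) := by
    calc ∑ k, |a k| ≤ ∑ k : Fin N, B * r ^ (l : ℕ) * q⁻¹ ^ (k : ℕ) :=
          Finset.sum_le_sum fun k _ => ha k
      _ = B * r ^ (l : ℕ) * ∑ k ∈ Finset.range N, q⁻¹ ^ k := by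
          rw [← Finset.mul_sum, Fin.sum_univ_eq_sum_range (fun k => q⁻¹ ^ k)]
      _ ≤ B * r ^ (l : ℕ) * (1 - q⁻¹)⁻¹ := by
          gcongr
          exact geom_sum_range_le (by positivity) (inv_lt_one_of_one_lt₀ hq) N
      _ = _ := by ring
  rw [hsplit]
  calc ∑ k, |(a + w) k| ≤ ∑ k, (|a k| + |w k|) := Finset.sum_le_sum fun k _ => abs_add_le _ _
    _ = ∑ k, |a k| + ∑ k, |w k| := Finset.sum_add_distrib
    _ ≤ _ := by linarith

/-- Apply `nodeH` to the difference x of the columns instead of comparing two inverses: the limit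
column enters only through its ℓ¹ bound C, and coercivity is used once. -/
theorem sqrt_dotProduct_col_sub_le {T v : ℝ → ℝ} (hv : IncrementBound T v)
    (hT : Set.MapsTo T (Set.Icc (-1) 1) (Set.Icc (-1) 1)) {N M : ℕ} {δ : ℝ} (hM : 0 < M)
    (hδ : 0 ≤ δ) (hδ' : δ ≤ 2 / (M : ℝ)) (hNM : 16 * (N : ℝ) ^ 2 * ((1 + √2) ^ 2) ^ N ≤ M)
    (l : Fin N) {C : ℝ} (hC : ∑ k, |((limitH N)⁻¹ *ᵥ (limitG T N).col l) k| ≤ C) :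
    √(((nodeH N M δ)⁻¹ * nodeG T N M δ - (limitH N)⁻¹ * limitG T N).col l ⬝ᵥ
        ((nodeH N M δ)⁻¹ * nodeG T N M δ - (limitH N)⁻¹ * limitG T N).col l)
      ≤ 4 * ((1 + √2) ^ 2) ^ N * ((v 1 - v (-1) + 2 + 4 * C) * ((N : ℝ) ^ 2 / M)) := by
  have hM' : (0 : ℝ) < M := by exact_mod_cast hM
  have hcoer := nodeH_coercive hM hδ hδ' hNM
  have hdet := (Matrix.isUnit_iff_isUnit_det _).1 (isUnit_limitH N)
  have hdet' := (Matrix.isUnit_iff_isUnit_det _).1 (isUnit_of_coercive (by positivity) hcoer)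
  set u := (limitH N)⁻¹ *ᵥ (limitG T N).col l with hu
  set x := ((nodeH N M δ)⁻¹ * nodeG T N M δ - (limitH N)⁻¹ * limitG T N).col l with hx
  have hcol : ∀ A B : Matrix (Fin N) (Fin N) ℝ, (A * B).col l = A *ᵥ B.col l := fun A B => rfl
  have hx' : x = (nodeH N M δ)⁻¹ *ᵥ (nodeG T N M δ).col l - u := by
    rw [hx, hu, ← hcol, ← hcol]; rfl
  have hHx : nodeH N M δ *ᵥ x
      = (nodeG T N M δ - limitG T N).col l - (nodeH N M δ - limitH N) *ᵥ u := by
    have h1 : limitH N *ᵥ u = (limitG T N).col l := by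
      rw [hu, mulVec_mulVec, mul_nonsing_inv _ hdet, one_mulVec]
    rw [hx', mulVec_sub, mulVec_mulVec, mul_nonsing_inv _ hdet', one_mulVec, sub_mulVec, h1]
    have h2 : (nodeG T N M δ - limitG T N).col l
      = (nodeG T N M δ).col l - (limitG T N).col l := rfl
    rw [h2]
    abel
  have hent : ∀ k, |(nodeH N M δ *ᵥ x) k| ≤ (v 1 - v (-1) + 2 + 4 * C) * N / M := by
    intro k
    rw [hHx]
    have h1 := abs_nodeG_sub_limitG_le hv hT (N := N) hM hδ hδ' k l
    have h2 := abs_mulVec_le (abs_nodeH_sub_limitH_le (N := N) hM hδ hδ') u k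
    have h3 : 4 * N / (M : ℝ) * ∑ l, |u l| ≤ 4 * N / M * C := by gcongr
    calc _ ≤ |(nodeG T N M δ - limitG T N) k l| + |((nodeH N M δ - limitH N) *ᵥ u) k| :=
          abs_sub _ _
      _ ≤ (v 1 - v (-1) + 2) * N / M + 4 * N / M * C := add_le_add h1 (h2.trans h3)
      _ = _ := by ring
  have hsum : ∑ k, |(nodeH N M δ *ᵥ x) k| ≤ (v 1 - v (-1) + 2 + 4 * C) * ((N : ℝ) ^ 2 / M) := by
    calc _ ≤ ∑ _k : Fin N, (v 1 - v (-1) + 2 + 4 * C) * N / M :=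
          Finset.sum_le_sum fun k _ => hent k
      _ = _ := by simp; ring
  have h := ((mul_sqrt_dotProduct_le_of_coercive hcoer x).trans
    (sqrt_dotProduct_le_sum_abs _)).trans hsum
  rwa [div_div, one_div, inv_mul_le_iff₀ (by positivity)] at h

theorem norm_lift_diagonal_mul_mul_diagonal_le {N : ℕ} (A : Matrix (Fin N) (Fin N) ℝ) {ρ : ℝ}
    (hρ : 1 ≤ ρ) :
    ‖lift (diagonal (fun n : Fin N => ρ ^ (n : ℕ)) * A
        * diagonal fun n : Fin N => (ρ ^ (n : ℕ))⁻¹)‖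
      ≤ ∑ l : Fin N, ρ ^ N * (ρ ^ (l : ℕ))⁻¹ * √(A.col l ⬝ᵥ A.col l) := by
  have hρ0 : 0 < ρ := by linarith
  refine (norm_lift_le _).trans (Finset.sum_le_sum fun l _ => ?_)
  have hA : 0 ≤ A.col l ⬝ᵥ A.col l := Finset.sum_nonneg fun k _ => mul_self_nonneg _
  rw [Real.sqrt_le_left (by positivity), mul_pow, Real.sq_sqrt hA, dotProduct, dotProduct,
    Finset.mul_sum]
  refine Finset.sum_le_sum fun k _ => ?_
  simp only [col_apply, mul_diagonal, diagonal_mul]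
  have h1 : ρ ^ (k : ℕ) ≤ ρ ^ N := pow_le_pow_right₀ hρ k.2.le
  calc _ = (ρ ^ (k : ℕ) * (ρ ^ (l : ℕ))⁻¹) ^ 2 * (A k l * A k l) := by ring
    _ ≤ _ := by
      refine mul_le_mul_of_nonneg_right ?_ (mul_self_nonneg _)
      gcongr

end EDMD

/-! ### Summation of the column errors -/

theorem proposition13 (T : ℝ → ℝ) (d : ℕ) (I : Fin d → Set ℝ)
    (hT : EDMD.IsAnalyticFullBranchMap T d I)
    (r R : ℝ) (hr : 1 < r) (hrR : r < R)
    (φ : Fin d → ℂ → ℂ)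
    (hφ : ∀ l, EDMD.IsInverseBranchExtension T (I l) r R (φ l))
    (γ : ℝ) (hγ : γ = (1 + Real.sqrt 2) ^ 2) (hexp : r / R < 1 / γ)
    (ρ : ℝ) (hρ : ρ ∈ Set.Ioo r R) :
    ∃ C₁ C₂ : ℝ, 0 < C₁ ∧ 0 < C₂ ∧
      ∀ (N M : ℕ) (δ : ℝ), 0 < M → 0 ≤ δ → δ ≤ 2 / (M : ℝ) →
        C₁ * (N : ℝ) ^ 2 * γ ^ N ≤ (M : ℝ) →
        IsUnit (EDMD.limitH N) ∧ IsUnit (EDMD.nodeH N M δ) ∧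
        ‖EDMD.opV ρ N ∘L EDMD.opNodeHdagger N M δ ∘L EDMD.opNodeG T N M δ ∘L EDMD.opVinv ρ N
            - EDMD.opV ρ N ∘L EDMD.opHdagger N ∘L EDMD.opG T N ∘L EDMD.opVinv ρ N‖
          ≤ C₂ * (ρ * γ) ^ N * ((N : ℝ) ^ 2 / (M : ℝ)) := by
  have hγ0 : 0 < γ := by rw [hγ]; positivity
  have hR0 : 0 < R := by linarith
  have hr0 : 0 < r := by linarith
  have hρr : r < ρ := hρ.1
  have hρ0 : 0 < ρ := hr0.trans hρr
  -- γ < rγ < R, because r > 1.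
  have hγR : (1 + √2) ^ 2 < R := by
    rw [div_lt_div_iff₀ hR0 hγ0, one_mul] at hexp
    rw [← hγ]
    nlinarith
  obtain ⟨C, hC0, hC⟩ := EDMD.exists_sum_abs_limitH_inv_mul_limitG_le hT hr0 hγR hφ
  obtain ⟨v, hv⟩ := hT.exists_incrementBound
  have hv0 : 0 ≤ v 1 - v (-1) :=
    sub_nonneg.2 (hv.monotoneOn (by simp) (by simp) (by norm_num))
  have hrρ : r / ρ < 1 := (div_lt_one hρ0).2 hρr
  have hrρ' : 0 < 1 - r / ρ := by linarith
  set D : ℝ := v 1 - v (-1) + 2 + 4 * C with hD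
  have hD0 : 0 < D := by rw [hD]; linarith
  -- 16 is the threshold in `nodeH_coercive`, 4 inverts its constant 1/4, and (1 - r/ρ)⁻¹ sums the
  -- columns.
  refine ⟨16, 4 * D * (1 - r / ρ)⁻¹, by norm_num, by positivity,
    fun N M δ hM hδ hδ' hNM => ⟨EDMD.isUnit_limitH N, ?_, ?_⟩⟩
  · rw [hγ] at hNM
    exact EDMD.isUnit_of_coercive (by positivity) (EDMD.nodeH_coercive hM hδ hδ' hNM)
  have hM' : (0 : ℝ) < M := by exact_mod_cast hM
  simp only [EDMD.opV, EDMD.opNodeHdagger, EDMD.opNodeG, EDMD.opVinv, EDMD.opHdagger, EDMD.opG,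
    EDMD.lift_comp]
  rw [← EDMD.lift_sub, ← mul_sub, ← mul_assoc _ _ (Matrix.diagonal _),
    ← mul_assoc _ _ (Matrix.diagonal _), ← sub_mul, ← mul_assoc]
  refine (EDMD.norm_lift_diagonal_mul_mul_diagonal_le _ (by linarith)).trans ?_
  have hcol : ∀ l : Fin N, ρ ^ N * (ρ ^ (l : ℕ))⁻¹ *
      √(((EDMD.nodeH N M δ)⁻¹ * EDMD.nodeG T N M δ
          - (EDMD.limitH N)⁻¹ * EDMD.limitG T N).col l ⬝ᵥ
        ((EDMD.nodeH N M δ)⁻¹ * EDMD.nodeG T N M δ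
          - (EDMD.limitH N)⁻¹ * EDMD.limitG T N).col l)
      ≤ 4 * D * (ρ * γ) ^ N * ((N : ℝ) ^ 2 / M) * (r / ρ) ^ (l : ℕ) := by
    intro l
    have h := EDMD.sqrt_dotProduct_col_sub_le hv hT.mapsTo hM hδ hδ' (hγ ▸ hNM) l (hC N l)
    rw [← hγ] at h
    have hrl : 1 ≤ r ^ (l : ℕ) := one_le_pow₀ hr.le
    -- As r^l ≥ 1, the quadrature error of G, which does not depend on l, is absorbed in the growth
    -- r^l.
    have h2 : v 1 - v (-1) + 2 + 4 * (C * r ^ (l : ℕ)) ≤ D * r ^ (l : ℕ) := by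
      rw [hD]; nlinarith
    calc _ ≤ ρ ^ N * (ρ ^ (l : ℕ))⁻¹ * (4 * γ ^ N * (D * r ^ (l : ℕ) * ((N : ℝ) ^ 2 / M))) := by
          gcongr
          exact h.trans (by gcongr)
      _ = _ := by rw [mul_pow, div_pow]; ring
  refine (Finset.sum_le_sum fun l _ => hcol l).trans ?_
  rw [← Finset.mul_sum, Fin.sum_univ_eq_sum_range (fun l => (r / ρ) ^ l)]
  calc _ ≤ 4 * D * (ρ * γ) ^ N * ((N : ℝ) ^ 2 / M) * (1 - r / ρ)⁻¹ := by
        gcongr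
        exact EDMD.geom_sum_range_le (by positivity) hrρ N
    _ = _ := by ring
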